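/- **Setting.** Fix attribute types, each with an infinite set of values, and relation names, each with a schema (a finite list of typed attributes). For a schema $\sigma$, $\mathrm{Tuple}(\sigma)$ is the set of tuples with schema $\sigma$. A conjunctive query (CQ) is `SELECT p FROM R_1 t_1, ..., R_n t_n WHERE b`, where $b$ is a conjunction of equalities between expressions of equal type, $p$ is a list of expressions matching the output schema, and an expression is an attribute $t_i.a$ or a constant. A CQ is satisfiable if some choice of tuples $t_1,\dots,t_n$ makes $b$ true; this is automatic if $b$ contains no constants. A union of conjunctive queries (UCQ) is a finite `UNION ALL` of CQs with one output schema. On an instance $I$ assigning to each relation a finite bag of tuples (i.e. a finitely supported multiplicity function $I(R):\mathrm{Tuple}(\sigma_R)\to\mathbb N$), the multiplicity of a tuple $r$ in the answer of a CQ is $\sum \prod_{i} I(R_i)(t_i)$, summed over all $(t_1,\dots,t_n)$ satisfying $b$ whose projection under $p$ is $r$; for a UCQ these multiplicities are added. Two UCQs are bag-equivalent if they give every output tuple the same multiplicity on every such instance. **Algorithm UDP (no integrity constraints).** A CQ with output tuple $t$ is translated to the term $\sum_{t_1,\dots,t_n}\prod_j [t.j=p_j]\times[b]\times R_1(t_1)\times\cdots\times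 R_n(t_n)$ and a UCQ to the formal sum of the terms of its CQs. On two such sums UDP proceeds as follows. 1. *Canonize* every term: add the transitive closure of its equalities; then, as long as possible, remove a summation by $\sum_{x}[x=e]\times f(x)=f(e)$, where $x$ does not occur in $e$ and $[x=e]$ is either a factor equating two tuple variables or, if $x$ is not the argument of a relation factor $R(x)$, given by factors $[x.a=e_a]$ for all attributes $a$ of $x$. 2. Return false if the numbers of terms differ. Otherwise return true if and only if, for some permutation of the terms of the first sum, each of its terms $T_1$ passes the following test against the corresponding term $T_2$ of the second sum: there is a schema-preserving bijection from the summation variables of $T_2$ to those of $T_1$ such that, after renaming $T_2$ by it, the conjunctions of equalities of the two terms are equivalent by congruence closure (constants being treated as opaque symbols) and the two terms have the same multiset of relation factors $R(x)$. **Theorem.** UDP is complete for unions of conjunctive queries under bag semantics: if $Q_1$ and $Q_2$ are bag-equivalent UCQs, all of whose CQs are satisfiable, then UDP returns true on the translations of $Q_1$ and $Q_2$. -/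

import Mathlib

/-! ## Conjunctive queries and their unions, with bag semantics

`Ty` is the set of attribute types, `dom τ` the set of values of type `τ`, `Rel` the set of
relation names, and `sch R` the schema of `R`: the list of the types of its attributes.
An attribute is named by its position in the schema. -/

namespace SQL

/-- `Tuple(s)`: the tuples with schema `s`. -/
abbrev Row {Ty : Type*} (dom : Ty → Type*) (s : List Ty) : Type _ :=
  (a : Fin s.length) → dom (s.get a)

/-- Scalar expressions of a conjunctive query whose FROM clause is
`tbl 0 AS x₀, …, tbl (n-1) AS xₙ₋₁`: attributes `x.a` and constants. -/
inductive Scalar {Ty Rel : Type*} (dom : Ty → Type*) (sch : Rel → List Ty) {n : ℕ}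
    (tbl : Fin n → Rel) : Ty → Type _
  | attr (x : Fin n) (a : Fin (sch (tbl x)).length) :
      Scalar dom sch tbl ((sch (tbl x)).get a)
  | const {τ : Ty} (c : dom τ) : Scalar dom sch tbl τ

/-- The value of a scalar expression when the table alias `x` is bound to the tuple `t x`. -/
def Scalar.eval {Ty Rel : Type*} {dom : Ty → Type*} {sch : Rel → List Ty} {n : ℕ}
    {tbl : Fin n → Rel} (t : (x : Fin n) → Row dom (sch (tbl x))) :
    {τ : Ty} → Scalar dom sch tbl τ → dom τ
  | _, .attr x a => t x a
  | _, .const c => c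

/-- An equality predicate `lhs = rhs` between scalar expressions of one type. -/
structure Equality {Ty Rel : Type*} (dom : Ty → Type*) (sch : Rel → List Ty) {n : ℕ}
    (tbl : Fin n → Rel) where
  ty : Ty
  lhs : Scalar dom sch tbl ty
  rhs : Scalar dom sch tbl ty

/-- A conjunctive query `SELECT proj FROM tbl 0 x₀, …, tbl (n-1) xₙ₋₁ WHERE cond` with output
schema `o`, where `cond` is a conjunction of equality predicates. -/
structure CQ {Ty Rel : Type*} (dom : Ty → Type*) (sch : Rel → List Ty) (o : List Ty) where
  n : ℕ
  tbl : Fin n → Rel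
  cond : List (Equality dom sch tbl)
  proj : (j : Fin o.length) → Scalar dom sch tbl (o.get j)

/-- A union of conjunctive queries `q₁ UNION ALL … UNION ALL qₘ`. -/
abbrev UCQ {Ty Rel : Type*} (dom : Ty → Type*) (sch : Rel → List Ty) (o : List Ty) : Type _ :=
  List (CQ dom sch o)

/-- A database instance under bag semantics: every relation is a finite bag of tuples,
given by the multiplicity of each tuple. -/
abbrev BagInstance {Ty Rel : Type*} (dom : Ty → Type*) (sch : Rel → List Ty) : Type _ :=
  (R : Rel) → (Row dom (sch R) →₀ ℕ)

/-- The WHERE clause holds when each alias `x` is bound to the tuple `t x`. -/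
def CQ.Holds {Ty Rel : Type*} {dom : Ty → Type*} {sch : Rel → List Ty} {o : List Ty}
    (q : CQ dom sch o) (t : (x : Fin q.n) → Row dom (sch (q.tbl x))) : Prop :=
  ∀ b ∈ q.cond, b.lhs.eval t = b.rhs.eval t

/-- The WHERE clause is not contradictory. -/
def CQ.Satisfiable {Ty Rel : Type*} {dom : Ty → Type*} {sch : Rel → List Ty} {o : List Ty}
    (q : CQ dom sch o) : Prop :=
  ∃ t : (x : Fin q.n) → Row dom (sch (q.tbl x)), q.Holds t

open Classical in
/-- The multiplicity of the tuple `r` in the answer of a conjunctive query: the sum, over all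
bindings of the aliases that satisfy the WHERE clause and project to `r`, of the product of the
multiplicities of the tuples used. -/
noncomputable def CQ.mult {Ty Rel : Type*} {dom : Ty → Type*} {sch : Rel → List Ty}
    {o : List Ty} (q : CQ dom sch o) (I : BagInstance dom sch) (r : Row dom o) : ℕ :=
  ∑ t ∈ Fintype.piFinset (fun x : Fin q.n => (I (q.tbl x)).support),
    if q.Holds t ∧ ∀ j, (q.proj j).eval t = r j then ∏ x, I (q.tbl x) (t x) else 0

/-- The multiplicity of the tuple `r` in the answer of a union of conjunctive queries. -/
noncomputable def UCQ.mult {Ty Rel : Type*} {dom : Ty → Type*} {sch : Rel → List Ty}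
    {o : List Ty} (q : UCQ dom sch o) (I : BagInstance dom sch) (r : Row dom o) : ℕ :=
  (q.map fun c => c.mult I r).sum

/-- Equivalence under bag semantics: the same answer, with the same multiplicities, on every
finite bag instance. -/
def BagEquivalent {Ty Rel : Type*} {dom : Ty → Type*} {sch : Rel → List Ty}
    {o : List Ty} (q₁ q₂ : UCQ dom sch o) : Prop :=
  ∀ (I : BagInstance dom sch) (r : Row dom o), UCQ.mult q₁ I r = UCQ.mult q₂ I r

end SQL

/-! ## U-expressions in sum-product normal form

`C` is the type of constants. A query denotes a function of its output tuple, which is the only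
free tuple variable, `out`; all other tuple variables are bound by summations and named by
natural numbers. -/

namespace UExp

/-- Tuple variables. -/
inductive Tup
  | var (x : ℕ)
  | out
  deriving DecidableEq

/-- Scalar expressions: attributes `t.a` and constants. -/
inductive Expr (C : Type*)
  | attr (t : Tup) (a : ℕ)
  | const (c : C)
  deriving DecidableEq

/-- Equality predicates `[e = e']` on scalars and `[t = t']` on tuples. -/
inductive Pred (C : Type*)
  | eq (e e' : Expr C)
  | teq (t t' : Tup)
  deriving DecidableEq

/-- A term `∑_{x₁ : Tuple(σ₁), …, xₘ : Tuple(σₘ)} [b₁] × ⋯ × [bₖ] × R₁(t₁) × ⋯ × Rⱼ(tⱼ)` in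
sum-product normal form. The factors `‖1‖` and `not(0)`, which are omitted in the normal form,
are the only squashed and negated factors that occur for queries without DISTINCT and NOT. -/
structure Term (Ty Rel C : Type*) where
  vars : List (ℕ × List Ty)
  preds : List (Pred C)
  atoms : List (Rel × Tup)

/-- A U-expression in sum-product normal form: a sum of terms. -/
abbrev SPNF (Ty Rel C : Type*) : Type _ := List (Term Ty Rel C)

/-! ### Congruence procedure -/

/-- The representative of `w`, given the list of merges made so far: `(u, v)` in this list means
that the class with representative `u` was merged into the class with representative `v`. -/
def find {α : Type*} [DecidableEq α] (log : List (α × α)) (w : α) : α :=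
  log.foldl (fun r m => if r = m.1 then m.2 else r) w

/-- Starting with one-element classes, merge the classes of `u` and `v` for each `(u, v)` in
`es`. -/
def mergeAll {α : Type*} [DecidableEq α] (es : List (α × α)) : List (α × α) :=
  es.foldl (fun log e => log ++ [(find log e.1, find log e.2)]) []

/-- The tuple equalities in `ps`. -/
def tupEqs {C : Type*} (ps : List (Pred C)) : List (Tup × Tup) :=
  ps.filterMap fun p => match p with
    | .teq t t' => some (t, t')
    | .eq _ _ => none

/-- Representatives of tuple variables modulo the tuple equalities in `ps`. -/
def repTup {C : Type*} (ps : List (Pred C)) (t : Tup) : Tup :=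
  find (mergeAll (tupEqs ps)) t

/-- `t.a` is replaced by `t'.a` with `t'` the representative of `t`. -/
def Expr.norm {C : Type*} (ps : List (Pred C)) : Expr C → Expr C
  | .attr t a => .attr (repTup ps t) a
  | .const c => .const c

/-- The scalar equalities in `ps`, up to tuple equalities. -/
def exprEqs {C : Type*} (ps : List (Pred C)) : List (Expr C × Expr C) :=
  ps.filterMap fun p => match p with
    | .eq e e' => some (e.norm ps, e'.norm ps)
    | .teq _ _ => none

/-- Representatives of scalar expressions modulo the congruence generated by `ps`. -/
def repExpr {C : Type*} [DecidableEq C] (ps : List (Pred C)) (e : Expr C) : Expr C :=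
  find (mergeAll (exprEqs ps)) (e.norm ps)

/-- Does the conjunction `ps` imply the equality `p`, by congruence? -/
def implies {C : Type*} [DecidableEq C] (ps : List (Pred C)) : Pred C → Bool
  | .eq e e' => decide (repExpr ps e = repExpr ps e')
  | .teq t t' => decide (repTup ps t = repTup ps t')

/-- Are the two conjunctions of equalities equivalent? -/
def predsEquiv {C : Type*} [DecidableEq C] (ps qs : List (Pred C)) : Bool :=
  qs.all (implies ps) && ps.all (implies qs)

/-! ### Substitution -/

/-- Substitute `f t` for every tuple variable `t`. -/
def Expr.subst {C : Type*} (f : Tup → Tup) : Expr C → Expr C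
  | .attr t a => .attr (f t) a
  | .const c => .const c

def Pred.subst {C : Type*} (f : Tup → Tup) : Pred C → Pred C
  | .eq e e' => .eq (e.subst f) (e'.subst f)
  | .teq t t' => .teq (f t) (f t')

/-- Substitute `es[a]` for the attribute `x.a`, for each `a`. -/
def Expr.substAttr {C : Type*} (x : ℕ) (es : List (Expr C)) : Expr C → Expr C
  | .attr t a => if t = .var x then es.getD a (.attr t a) else .attr t a
  | .const c => .const c

def Pred.substAttr {C : Type*} (x : ℕ) (es : List (Expr C)) : Pred C → Pred C
  | .eq e e' => .eq (e.substAttr x es) (e'.substAttr x es)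
  | .teq t t' => .teq t t'

/-- Does the bound variable `x` occur in the expression? -/
def Expr.mentions {C : Type*} (x : ℕ) : Expr C → Bool
  | .attr t _ => decide (t = .var x)
  | .const _ => false

/-- The predicates `[e = e]` and `[t = t]`, which are equal to `1`. -/
def Pred.trivial {C : Type*} [DecidableEq C] : Pred C → Bool
  | .eq e e' => decide (e = e')
  | .teq t t' => decide (t = t')

/-! ### Canonization, without integrity constraints -/

/-- The scalar expressions that are sides of an equality. -/
def Pred.exprs {C : Type*} : Pred C → List (Expr C)
  | .eq e e' => [e, e']
  | .teq _ _ => []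

/-- The tuple variables that are sides of an equality. -/
def Pred.tups {C : Type*} : Pred C → List Tup
  | .eq _ _ => []
  | .teq t t' => [t, t']

/-- Transitive closure: add every implied equality between sides of the given equalities. -/
def Term.tc {Ty Rel C : Type*} [DecidableEq C] (T : Term Ty Rel C) : Term Ty Rel C :=
  let es := T.preds.flatMap Pred.exprs
  let ts := T.preds.flatMap Pred.tups
  let cand := es.flatMap (fun e => es.map (Pred.eq e)) ++
    ts.flatMap (fun t => ts.map (Pred.teq t))
  { T with preds := T.preds ++ cand.filter (implies T.preds) }

/-- The first tuple `t`, other than `x` itself, for which `[x = t]` is a factor. -/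
def Term.tupleFor {Ty Rel C : Type*} (T : Term Ty Rel C) (x : ℕ) : Option Tup :=
  T.preds.findSome? fun p => match p with
    | .teq t t' =>
        if t = .var x ∧ t' ≠ .var x then some t'
        else if t' = .var x ∧ t ≠ .var x then some t else none
    | .eq _ _ => none

/-- The first expression `e` without `x` for which `[x.a = e]` is a factor. -/
def Term.exprFor {Ty Rel C : Type*} [DecidableEq C] (T : Term Ty Rel C) (x a : ℕ) :
    Option (Expr C) :=
  T.preds.findSome? fun p => match p with
    | .eq e e' =>
        if e = .attr (.var x) a ∧ e'.mentions x = false then some e'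
        else if e' = .attr (.var x) a ∧ e.mentions x = false then some e else none
    | .teq _ _ => none

/-- One application of `∑_x [x = e] × f(x) = f(e)` to the summation over `x : Tuple(s)`.
The equality `[x = e]` is either a factor `[x = t]`, or it is given attribute by attribute by
factors `[x.a = eₐ]` for all attributes `a`. In the second case `x` must not be the argument of
a relation, because the factors `R(t)` of a term in normal form have a tuple variable `t` as
argument, and not the row `(e₀, e₁, …)`. -/
def Term.elimVar {Ty Rel C : Type*} [DecidableEq C] (T : Term Ty Rel C) (x : ℕ)
    (s : List Ty) : Option (Term Ty Rel C) :=
  let rest := T.vars.filter (fun v => decide (v.1 ≠ x))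
  match T.tupleFor x with
  | some t =>
      let f : Tup → Tup := fun u => if u = .var x then t else u
      some ⟨rest, (T.preds.map (Pred.subst f)).filter (fun p => !p.trivial),
        T.atoms.map (fun m => (m.1, f m.2))⟩
  | none =>
      if T.atoms.any (fun m => decide (m.2 = .var x)) then none
      else match (List.range s.length).mapM (T.exprFor x) with
        | some es =>
            some ⟨rest, (T.preds.map (Pred.substAttr x es)).filter (fun p => !p.trivial),
              T.atoms⟩
        | none => none

/-- Remove unnecessary summations, at most `k` times. -/
def Term.elim {Ty Rel C : Type*} [DecidableEq C] : ℕ → Term Ty Rel C → Term Ty Rel C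
  | 0, T => T
  | k + 1, T =>
      match T.vars.findSome? (fun v => T.elimVar v.1 v.2) with
      | some T' => Term.elim k T'
      | none => T

/-- Each removal of a summation removes a variable, so the bound on the number of steps lets the
removal run until it is no longer applicable. -/
def Term.canonize {Ty Rel C : Type*} [DecidableEq C] (T : Term Ty Rel C) : Term Ty Rel C :=
  T.tc.elim T.vars.length

def canonize {Ty Rel C : Type*} [DecidableEq C] (E : SPNF Ty Rel C) : SPNF Ty Rel C :=
  E.map Term.canonize

/-! ### The decision procedure -/

/-- The renaming of the `i`-th name in `xs` to the `i`-th name in `ys`. -/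
def varMap (xs ys : List ℕ) : Tup → Tup
  | .var x => .var (((xs.zip ys).lookup x).getD x)
  | .out => .out

/-- Decision procedure for terms: look for a bijection from the summation variables of `T₂` to
those of `T₁`, compatible with their schemas, after which the predicate parts are equivalent by
congruence and the relation factors are the same. -/
def tdp {Ty Rel C : Type*} [DecidableEq Ty] [DecidableEq Rel] [DecidableEq C]
    (T₁ T₂ : Term Ty Rel C) : Bool :=
  T₁.vars.permutations.any fun l =>
    decide (l.map Prod.snd = T₂.vars.map Prod.snd) &&
      (let p := varMap (T₂.vars.map Prod.fst) (l.map Prod.fst)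
       predsEquiv T₁.preds (T₂.preds.map (Pred.subst p)) &&
        decide (T₁.atoms.Perm (T₂.atoms.map fun m => (m.1, p m.2))))

/-- The decision procedure UDP, without integrity constraints: canonize both expressions and look
for a permutation of the terms of the first that makes them pairwise equivalent to the terms of
the second. -/
def udp {Ty Rel C : Type*} [DecidableEq Ty] [DecidableEq Rel] [DecidableEq C]
    (E₁ E₂ : SPNF Ty Rel C) : Bool :=
  let F₁ := canonize E₁
  let F₂ := canonize E₂
  if F₁.length ≠ F₂.length then false
  else F₁.permutations.any fun p => (p.zip F₂).all fun T => tdp T.1 T.2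

end UExp

/-! ## Translation of queries to U-expressions -/

namespace SQL

/-- Constants of all types. -/
abbrev Const {Ty : Type*} (dom : Ty → Type*) : Type _ := (τ : Ty) × dom τ

def Scalar.toUExp {Ty Rel : Type*} {dom : Ty → Type*} {sch : Rel → List Ty} {n : ℕ}
    {tbl : Fin n → Rel} : {τ : Ty} → Scalar dom sch tbl τ → UExp.Expr (Const dom)
  | _, .attr x a => .attr (.var x) a
  | τ, .const c => .const ⟨τ, c⟩

/-- `∑_{x₀, …, xₙ₋₁} ∏_j [out.j = proj j] × [cond] × ∏_x (tbl x)(x)`. -/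
def CQ.toUExp {Ty Rel : Type*} {dom : Ty → Type*} {sch : Rel → List Ty} {o : List Ty}
    (q : CQ dom sch o) : UExp.Term Ty Rel (Const dom) where
  vars := List.ofFn fun x : Fin q.n => ((x : ℕ), sch (q.tbl x))
  preds := (List.ofFn fun j : Fin o.length =>
      UExp.Pred.eq (.attr .out j) (q.proj j).toUExp) ++
    q.cond.map fun b => UExp.Pred.eq b.lhs.toUExp b.rhs.toUExp
  atoms := List.ofFn fun x : Fin q.n => (q.tbl x, UExp.Tup.var x)

/-- The U-expression, in sum-product normal form, of a union of conjunctive queries. -/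
def UCQ.toUExp {Ty Rel : Type*} {dom : Ty → Type*} {sch : Rel → List Ty} {o : List Ty}
    (q : UCQ dom sch o) : UExp.SPNF Ty Rel (Const dom) :=
  q.map CQ.toUExp

end SQL

/-! ### The congruence procedure decides the generated equivalence relation -/

namespace UExp

/-! When only the facts in a finite set `F` are present, the multiplicity of a tuple in a bag answer
is a polynomial with natural coefficients in the multiplicities of these facts. Bag-equivalent
unions agree at all natural arguments, so their polynomials coincide (`BagEquivalent.sum_poly_eq`).

A satisfiable query `c` has a generic binding, in which only congruence consequences of its
equalities hold (`CQ.Satisfiable.exists_generic`). The product of the facts used is a monomial of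
`c`; natural coefficients cannot cancel, so some `d` in the other union has a binding with the same
multiset of facts. This yields a bijection of aliases, and genericity makes the equalities of `d`
follow from those of `c`: `d` covers `c` (`exists_covers_of_sum_poly_eq`).

For `c` maximal under covering among all queries of both unions, `c` also covers `d`. Mutual
covering is isomorphism, because a permutation of finitely many aliases has finite order
(`CQ.Covers.iso`). Isomorphic queries have equal polynomials, so the pair cancels and induction
matches up the two unions (`rel_iso_of_sum_poly_eq`).

On the side of the algorithm, canonization of a translated query only adds the transitive closure,
and genericity turns equality of bindings back into equivalence by congruence, which is what `tdp`
tests (`CQ.Iso.tdp`). -/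

theorem find_append_singleton {α : Type*} [DecidableEq α] (log : List (α × α)) (a b w : α) :
    find (log ++ [(a, b)]) w = if find log w = a then b else find log w := by
  simp only [find, List.foldl_append]
  rfl

theorem find_mergeAll_append_singleton {α : Type*} [DecidableEq α] (es : List (α × α))
    (x y w : α) :
    find (mergeAll (es ++ [(x, y)])) w =
      if find (mergeAll es) w = find (mergeAll es) x then find (mergeAll es) y
      else find (mergeAll es) w := by
  have h : mergeAll (es ++ [(x, y)]) =
      mergeAll es ++ [(find (mergeAll es) x, find (mergeAll es) y)] := by
    simp [mergeAll, List.foldl_append]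
  rw [h, find_append_singleton]

/-- Induction from the end of the list: a final pair `(x, y)` redirects exactly the class of `x` to
the representative of `y`. -/
theorem find_mergeAll_eq_iff {α : Type*} [DecidableEq α] (es : List (α × α)) (u v : α) :
    find (mergeAll es) u = find (mergeAll es) v ↔
      Relation.EqvGen (fun a b => (a, b) ∈ es) u v := by
  constructor
  · induction es using List.reverseRecOn generalizing u v with
    | nil => intro h; simp [find, mergeAll] at h; subst h; exact .refl _
    | append_singleton es e ih =>
      obtain ⟨x, y⟩ := e
      have hm : ∀ a b, find (mergeAll es) a = find (mergeAll es) b →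
          Relation.EqvGen (fun a b => (a, b) ∈ es ++ [(x, y)]) a b := fun a b h =>
        Relation.EqvGen.mono (fun _ _ h => List.mem_append_left _ h) _ _ (ih a b h)
      have hxy : Relation.EqvGen (fun a b => (a, b) ∈ es ++ [(x, y)]) x y :=
        .rel _ _ (by simp)
      rw [find_mergeAll_append_singleton, find_mergeAll_append_singleton]
      split_ifs with h₁ h₂ h₂
      · exact fun _ => hm _ _ (h₁.trans h₂.symm)
      · exact fun h => ((hm _ _ h₁).trans _ _ _ hxy).trans _ _ _ (hm _ _ h)
      · exact fun h => (hm _ _ h).trans _ _ _ (((hm _ _ h₂).trans _ _ _ hxy).symm)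
      · exact hm _ _
  · intro h
    induction h with
    | refl _ => rfl
    | symm _ _ _ ih => exact ih.symm
    | trans _ _ _ _ _ ih₁ ih₂ => exact ih₁.trans ih₂
    | rel u v h =>
      induction es using List.reverseRecOn with
      | nil => simp at h
      | append_singleton es e ih =>
        obtain ⟨x, y⟩ := e
        rw [find_mergeAll_append_singleton, find_mergeAll_append_singleton]
        rcases List.mem_append.1 h with h | h
        · rw [ih h]
        · simp only [List.mem_singleton, Prod.mk.injEq] at h
          obtain ⟨rfl, rfl⟩ := h
          simp

/-- All predicates are equalities of scalars. -/
def AllScalar {C : Type*} (ps : List (Pred C)) : Prop := ∀ p ∈ ps, ∃ u v, p = Pred.eq u v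

/-- The congruence generated by the scalar equalities in `ps`. -/
abbrev Cong {C : Type*} (ps : List (Pred C)) : Expr C → Expr C → Prop :=
  Relation.EqvGen fun u v => Pred.eq u v ∈ ps

theorem AllScalar.tupEqs {C : Type*} {ps : List (Pred C)} (h : AllScalar ps) :
    tupEqs ps = [] := by
  rw [UExp.tupEqs, List.filterMap_eq_nil_iff]
  intro p hp
  obtain ⟨u, v, rfl⟩ := h p hp
  rfl

theorem AllScalar.norm {C : Type*} {ps : List (Pred C)} (h : AllScalar ps) (e : Expr C) :
    e.norm ps = e := by
  cases e <;> simp [Expr.norm, repTup, h.tupEqs, mergeAll, find]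

theorem AllScalar.mem_exprEqs {C : Type*} {ps : List (Pred C)} (h : AllScalar ps)
    (u v : Expr C) : (u, v) ∈ exprEqs ps ↔ Pred.eq u v ∈ ps := by
  simp only [exprEqs, List.mem_filterMap]
  constructor
  · rintro ⟨p, hp, hq⟩
    obtain ⟨a, b, rfl⟩ := h p hp
    simp only [h.norm, Option.some.injEq, Prod.mk.injEq] at hq
    obtain ⟨rfl, rfl⟩ := hq
    exact hp
  · exact fun hp => ⟨_, hp, by simp [h.norm]⟩

theorem AllScalar.implies_eq_iff {C : Type*} [DecidableEq C] {ps : List (Pred C)}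
    (h : AllScalar ps) (u v : Expr C) : implies ps (.eq u v) = true ↔ Cong ps u v := by
  rw [implies, decide_eq_true_iff, repExpr, repExpr, h.norm, h.norm, find_mergeAll_eq_iff]
  simp only [h.mem_exprEqs]

/-! ### Canonization of terms in which every summation variable occurs in a relation -/

theorem Cong.mono {C : Type*} {ps qs : List (Pred C)}
    (h : ∀ u v, Pred.eq u v ∈ ps → Cong qs u v) {u v : Expr C} (huv : Cong ps u v) :
    Cong qs u v := by
  induction huv with
  | rel u v hm => exact h u v hm
  | refl _ => exact .refl _
  | symm _ _ _ ih => exact ih.symm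
  | trans _ _ _ _ _ ih₁ ih₂ => exact ih₁.trans _ _ _ ih₂

theorem Cong.subst {C : Type*} {ps : List (Pred C)} (f : Tup → Tup) {u v : Expr C}
    (huv : Cong ps u v) : Cong (ps.map (Pred.subst f)) (u.subst f) (v.subst f) := by
  induction huv with
  | rel u v hm => exact .rel _ _ (List.mem_map.2 ⟨_, hm, rfl⟩)
  | refl _ => exact .refl _
  | symm _ _ _ ih => exact ih.symm
  | trans _ _ _ _ _ ih₁ ih₂ => exact ih₁.trans _ _ _ ih₂

theorem AllScalar.map_subst {C : Type*} {ps : List (Pred C)} (h : AllScalar ps)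
    (f : Tup → Tup) : AllScalar (ps.map (Pred.subst f)) := by
  intro p hp
  obtain ⟨q, hq, rfl⟩ := List.mem_map.1 hp
  obtain ⟨u, v, rfl⟩ := h q hq
  exact ⟨_, _, rfl⟩

theorem Term.tc_preds_spec {Ty Rel C : Type*} [DecidableEq C] {T : Term Ty Rel C}
    (h : AllScalar T.preds) :
    ∀ p ∈ T.tc.preds, ∃ u v, p = Pred.eq u v ∧ Cong T.preds u v := by
  intro p hp
  have ht : T.preds.flatMap Pred.tups = [] := by
    rw [List.flatMap_eq_nil_iff]
    intro p hp
    obtain ⟨u, v, rfl⟩ := h p hp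
    rfl
  simp only [Term.tc, ht, List.flatMap_nil, List.append_nil, List.mem_append, List.mem_filter,
    List.mem_flatMap, List.mem_map] at hp
  rcases hp with hp | ⟨⟨u, _, v, _, rfl⟩, hi⟩
  · obtain ⟨u, v, rfl⟩ := h p hp
    exact ⟨u, v, rfl, .rel _ _ hp⟩
  · exact ⟨u, v, rfl, (h.implies_eq_iff u v).1 hi⟩

theorem AllScalar.tc {Ty Rel C : Type*} [DecidableEq C] {T : Term Ty Rel C}
    (h : AllScalar T.preds) : AllScalar T.tc.preds := fun p hp =>
  let ⟨u, v, hp, _⟩ := Term.tc_preds_spec h p hp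
  ⟨u, v, hp⟩

theorem Term.cong_tc_iff {Ty Rel C : Type*} [DecidableEq C] {T : Term Ty Rel C}
    (h : AllScalar T.preds) (u v : Expr C) : Cong T.tc.preds u v ↔ Cong T.preds u v := by
  constructor
  · refine Cong.mono fun u v huv => ?_
    obtain ⟨_, _, he, hc⟩ := Term.tc_preds_spec h _ huv
    cases he
    exact hc
  · exact Cong.mono fun u v huv => .rel _ _ (List.mem_append_left _ huv)

theorem Term.tupleFor_eq_none {Ty Rel C : Type*} {T : Term Ty Rel C} (h : AllScalar T.preds)
    (x : ℕ) : T.tupleFor x = none := by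
  rw [Term.tupleFor, List.findSome?_eq_none_iff]
  intro p hp
  obtain ⟨u, v, rfl⟩ := h p hp
  rfl

/-- Both ways of removing a summation are blocked: there are no tuple equalities, and every
summation variable is the argument of a relation factor. -/
theorem Term.canonize_eq_tc {Ty Rel C : Type*} [DecidableEq C] {T : Term Ty Rel C}
    (h : AllScalar T.preds) (hv : ∀ v ∈ T.vars, ∃ m ∈ T.atoms, m.2 = .var v.1) :
    T.canonize = T.tc := by
  have key : T.tc.vars.findSome? (fun v => T.tc.elimVar v.1 v.2) = none := by
    rw [List.findSome?_eq_none_iff]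
    intro v hmem
    have ha : T.tc.atoms.any (fun m => decide (m.2 = .var v.1)) = true := by
      obtain ⟨m, hm, he⟩ := hv v hmem
      exact List.any_eq_true.2 ⟨m, hm, decide_eq_true he⟩
    simp [Term.elimVar, Term.tupleFor_eq_none h.tc, ha]
  rw [Term.canonize]
  cases T.vars.length with
  | zero => rfl
  | succ k => simp [Term.elim, key]

end UExp

/-! ### Evaluation of untyped scalar expressions -/

namespace SQL

/-- A fact `R(t)`: a relation name with a tuple of its schema. -/
abbrev Fact {Ty Rel : Type*} (dom : Ty → Type*) (sch : Rel → List Ty) : Type _ :=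
  (R : Rel) × Row dom (sch R)

/-- The value of an expression when the variables are bound to the tuples of the facts `f` and
`out` to `r`; `none` for attributes that do not exist. -/
def exprVal {Ty Rel : Type*} {dom : Ty → Type*} {sch : Rel → List Ty} {o : List Ty} {n : ℕ}
    (f : Fin n → Fact dom sch) (r : Row dom o) : UExp.Expr (Const dom) → Option (Const dom)
  | .attr (.var x) a =>
      if h : ∃ hx : x < n, a < (sch (f ⟨x, hx⟩).1).length then
        some ⟨_, (f ⟨x, h.1⟩).2 ⟨a, h.2⟩⟩ else none
  | .attr .out a => if h : a < o.length then some ⟨_, r ⟨a, h⟩⟩ else none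
  | .const k => some k

/-- The facts `f` match the FROM clause of `q`, satisfy its WHERE clause and project to `r`. -/
def CQ.Match {Ty Rel : Type*} {dom : Ty → Type*} {sch : Rel → List Ty} {o : List Ty}
    (q : CQ dom sch o) (f : Fin q.n → Fact dom sch) (r : Row dom o) : Prop :=
  (∀ x, (f x).1 = q.tbl x) ∧
    ∀ u v, UExp.Pred.eq u v ∈ q.toUExp.preds → exprVal f r u = exprVal f r v

variable {Ty Rel : Type*} {dom : Ty → Type*} {sch : Rel → List Ty} {o : List Ty}

theorem exprVal_toUExp {n : ℕ} {tbl : Fin n → Rel} (t : (x : Fin n) → Row dom (sch (tbl x)))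
    (r : Row dom o) {τ : Ty} (s : Scalar dom sch tbl τ) :
    exprVal (fun x => (⟨tbl x, t x⟩ : Fact dom sch)) r s.toUExp = some ⟨τ, s.eval t⟩ := by
  cases s with
  | attr x a =>
    have h : ∃ hx : (x : ℕ) < n, (a : ℕ) < (sch (tbl ⟨x, hx⟩)).length := ⟨x.2, a.2⟩
    simp only [Scalar.toUExp, exprVal]
    rw [dif_pos h]
    rfl
  | const c => rfl

theorem exprVal_out {n : ℕ} (f : Fin n → Fact dom sch) (r : Row dom o) (j : Fin o.length) :
    exprVal f r (.attr .out j) = some ⟨o.get j, r j⟩ := by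
  simp only [exprVal]
  rw [dif_pos j.2]

theorem CQ.eq_mem_preds_iff (q : CQ dom sch o) (u v : UExp.Expr (Const dom)) :
    UExp.Pred.eq u v ∈ q.toUExp.preds ↔
      (∃ j : Fin o.length, u = .attr .out j ∧ v = (q.proj j).toUExp) ∨
        ∃ b ∈ q.cond, u = b.lhs.toUExp ∧ v = b.rhs.toUExp := by
  simp only [CQ.toUExp, List.mem_append, List.mem_ofFn, List.mem_map, UExp.Pred.eq.injEq]
  simp only [eq_comm]

theorem CQ.allScalar_preds (q : CQ dom sch o) : UExp.AllScalar q.toUExp.preds := by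
  intro p hp
  simp only [CQ.toUExp, List.mem_append, List.mem_ofFn, List.mem_map] at hp
  rcases hp with ⟨j, rfl⟩ | ⟨b, _, rfl⟩ <;> exact ⟨_, _, rfl⟩

theorem CQ.match_iff (q : CQ dom sch o) (t : (x : Fin q.n) → Row dom (sch (q.tbl x)))
    (r : Row dom o) :
    q.Match (fun x => ⟨q.tbl x, t x⟩) r ↔ q.Holds t ∧ ∀ j, (q.proj j).eval t = r j := by
  constructor
  · rintro ⟨-, h⟩
    refine ⟨fun b hb => ?_, fun j => ?_⟩
    · have := h _ _ ((q.eq_mem_preds_iff _ _).2 (Or.inr ⟨b, hb, rfl, rfl⟩))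
      simpa [exprVal_toUExp] using this
    · have := h _ _ ((q.eq_mem_preds_iff _ _).2 (Or.inl ⟨j, rfl, rfl⟩))
      rw [exprVal_out, exprVal_toUExp] at this
      simpa [eq_comm] using this
  · rintro ⟨hb, hj⟩
    refine ⟨fun _ => rfl, fun u v huv => ?_⟩
    rcases (q.eq_mem_preds_iff _ _).1 huv with ⟨j, rfl, rfl⟩ | ⟨b, hb', rfl, rfl⟩
    · rw [exprVal_out, exprVal_toUExp, hj]
    · rw [exprVal_toUExp, exprVal_toUExp, hb b hb']

theorem CQ.Match.cong {q : CQ dom sch o} {f : Fin q.n → Fact dom sch} {r : Row dom o}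
    (h : q.Match f r) {u v : UExp.Expr (Const dom)} (huv : UExp.Cong q.toUExp.preds u v) :
    exprVal f r u = exprVal f r v := by
  induction huv with
  | rel u v hm => exact h.2 u v hm
  | refl _ => rfl
  | symm _ _ _ ih => exact ih.symm
  | trans _ _ _ _ _ ih₁ ih₂ => exact ih₁.trans ih₂

theorem CQ.Satisfiable.exists_match {q : CQ dom sch o} (h : q.Satisfiable) :
    ∃ f r, q.Match f r := by
  obtain ⟨t, ht⟩ := h
  exact ⟨_, fun j => (q.proj j).eval t, (q.match_iff t _).2 ⟨ht, fun _ => rfl⟩⟩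

/-! ### Generic bindings -/

/-- `u` is an expression of type `τ` over the FROM clause `tbl` and the output schema `o`, whose
constants are in `K`. -/
def HasTy {n : ℕ} (tbl : Fin n → Rel) (o : List Ty) (K : Set (Const dom)) (sch : Rel → List Ty)
    (τ : Ty) : UExp.Expr (Const dom) → Prop
  | .attr (.var x) a =>
      ∃ (hx : x < n) (ha : a < (sch (tbl ⟨x, hx⟩)).length), (sch (tbl ⟨x, hx⟩)).get ⟨a, ha⟩ = τ
  | .attr .out a => ∃ ha : a < o.length, o.get ⟨a, ha⟩ = τ
  | .const k => k ∈ K ∧ k.1 = τ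

/-- The constants in a predicate. -/
def predConsts {C : Type*} : UExp.Pred C → Set C
  | .eq u v => {k | u = .const k ∨ v = .const k}
  | .teq _ _ => ∅

/-- The constants of a query. -/
def CQ.consts (q : CQ dom sch o) : Set (Const dom) :=
  {k | ∃ p ∈ q.toUExp.preds, k ∈ predConsts p}

theorem CQ.finite_consts (q : CQ dom sch o) : q.consts.Finite := by
  have : q.consts = ⋃ p ∈ {p | p ∈ q.toUExp.preds}, predConsts p := by
    ext k
    simp [CQ.consts]
  rw [this]
  refine (List.finite_toSet _).biUnion fun p _ => ?_
  cases p with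
  | teq => exact Set.finite_empty
  | eq u v =>
    refine Set.Finite.union (s := {k | u = .const k}) (t := {k | v = .const k}) ?_ ?_
    · exact Set.Subsingleton.finite fun a ha b hb => by
        simpa using (show u = .const a from ha).symm.trans hb
    · exact Set.Subsingleton.finite fun a ha b hb => by
        simpa using (show v = .const a from ha).symm.trans hb

theorem hasTy_toUExp {n : ℕ} {tbl : Fin n → Rel} {K : Set (Const dom)} {τ : Ty}
    (s : Scalar dom sch tbl τ) (hK : ∀ k, s.toUExp = .const k → k ∈ K) :
    HasTy tbl o K sch τ s.toUExp := by
  cases s with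
  | attr x a => exact ⟨x.2, a.2, rfl⟩
  | const c => exact ⟨hK _ rfl, rfl⟩

theorem CQ.hasTy_of_mem_preds (q : CQ dom sch o) {K : Set (Const dom)} (hK : q.consts ⊆ K)
    {u v : UExp.Expr (Const dom)} (h : UExp.Pred.eq u v ∈ q.toUExp.preds) :
    ∃ τ, HasTy q.tbl o K sch τ u ∧ HasTy q.tbl o K sch τ v := by
  have hu : ∀ k, u = .const k → k ∈ K := fun k hk => hK ⟨_, h, Or.inl hk⟩
  have hv : ∀ k, v = .const k → k ∈ K := fun k hk => hK ⟨_, h, Or.inr hk⟩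
  rcases (q.eq_mem_preds_iff _ _).1 h with ⟨j, rfl, rfl⟩ | ⟨b, -, rfl, rfl⟩
  · exact ⟨o.get j, ⟨j.2, rfl⟩, hasTy_toUExp _ hv⟩
  · exact ⟨b.ty, hasTy_toUExp _ hu, hasTy_toUExp _ hv⟩

theorem exists_fresh_values [∀ τ, Infinite (dom τ)] {K : Set (Const dom)} (hK : K.Finite)
    (τ : Ty) : ∃ g : ℕ → dom τ, Function.Injective g ∧ ∀ k, (⟨τ, g k⟩ : Const dom) ∉ K := by
  have hf : {c : dom τ | (⟨τ, c⟩ : Const dom) ∈ K}.Finite :=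
    hK.preimage (sigma_mk_injective.injOn)
  let g := hf.infinite_compl.natEmbedding
  exact ⟨fun k => (g k : dom τ), fun a b h => g.injective (Subtype.ext h), fun k => (g k).2⟩

open Classical in
/-- A satisfiable query has a binding which satisfies no equalities, between expressions with
constants in a given finite set, except those that follow by congruence. -/
theorem CQ.Satisfiable.exists_generic [∀ τ, Infinite (dom τ)] {q : CQ dom sch o}
    (h : q.Satisfiable) {K : Set (Const dom)} (hK : K.Finite) (hq : q.consts ⊆ K) :
    ∃ f r, q.Match f r ∧ ∀ τ τ' u v, HasTy q.tbl o K sch τ u → HasTy q.tbl o K sch τ' v →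
      exprVal f r u = exprVal f r v → UExp.Cong q.toUExp.preds u v := by
  choose g hg hgK using fun τ => exists_fresh_values hK τ
  let S : Setoid (UExp.Expr (Const dom)) := Relation.EqvGen.setoid
    (fun u v => UExp.Pred.eq u v ∈ q.toUExp.preds)
  let cl : UExp.Expr (Const dom) → Quotient S := Quotient.mk S
  have hcl : ∀ u v, cl u = cl v ↔ UExp.Cong q.toUExp.preds u v := fun u v => Quotient.eq (r := S)
  -- Only classes of attributes are numbered injectively; there are countably many of them, whereas
  -- the constants may be uncountable.
  obtain ⟨code, hcode⟩ : ∃ code : Quotient S → ℕ,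
      Set.InjOn code (Set.range fun p : Option ℕ × ℕ =>
        cl (.attr (p.1.elim .out .var) p.2)) :=
    Set.countable_iff_exists_injOn.1 (Set.countable_range _)
  have hrange : ∀ t a, cl (.attr t a) ∈ Set.range fun p : Option ℕ × ℕ =>
      cl (.attr (p.1.elim .out .var) p.2) := by
    rintro (x | _) a
    · exact ⟨(some x, a), rfl⟩
    · exact ⟨(none, a), rfl⟩
  obtain ⟨f₁, r₁, hm₁⟩ := h.exists_match
  -- Satisfiability enters here: an actual binding shows that the congruence never identifies two
  -- constants.
  have hconst : ∀ k k' : Const dom, cl (.const k) = cl (.const k') → k = k' := by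
    intro k k' hk
    have := hm₁.cong ((hcl _ _).1 hk)
    simpa [exprVal] using this
  -- A class containing a constant of `K` of type `τ` gets that constant as its value; any other
  -- class gets a fresh value outside `K`, determined by its number.
  let val : (τ : Ty) → UExp.Expr (Const dom) → dom τ := fun τ u =>
    if h : ∃ c : dom τ, (⟨τ, c⟩ : Const dom) ∈ K ∧ cl (.const ⟨τ, c⟩) = cl u then h.choose
    else g τ (code (cl u))
  have hval : ∀ τ u v, cl u = cl v → val τ u = val τ v := by
    intro τ u v huv
    simp only [val, huv]
  have hvalc : ∀ τ (c : dom τ), (⟨τ, c⟩ : Const dom) ∈ K → val τ (.const ⟨τ, c⟩) = c := by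
    intro τ c hc
    have hex : ∃ c' : dom τ, (⟨τ, c'⟩ : Const dom) ∈ K ∧
      cl (.const ⟨τ, c'⟩) = cl (.const ⟨τ, c⟩) := ⟨c, hc, rfl⟩
    have := hconst _ _ hex.choose_spec.2
    simp only [val]
    rw [dif_pos hex]
    simpa using this
  let f : Fin q.n → Fact dom sch := fun x =>
    ⟨q.tbl x, fun a => val _ (.attr (.var x) a)⟩
  let r : Row dom o := fun j => val _ (.attr .out j)
  have hev : ∀ τ u, HasTy q.tbl o K sch τ u → exprVal f r u = some ⟨τ, val τ u⟩ := by
    intro τ u hu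
    match u, hu with
    | .attr (.var x) a, ⟨hx, ha, hτ⟩ =>
      subst hτ
      have h : ∃ hx : x < q.n, a < (sch (f ⟨x, hx⟩).1).length := ⟨hx, ha⟩
      simp only [exprVal]
      rw [dif_pos h]
    | .attr .out a, ⟨ha, hτ⟩ =>
      subst hτ
      simp only [exprVal]
      rw [dif_pos ha]
    | .const ⟨_, c⟩, ⟨hk, hτ⟩ =>
      subst hτ
      simp only [exprVal, hvalc _ c hk]
  refine ⟨f, r, ⟨fun _ => rfl, fun u v huv => ?_⟩, fun τ τ' u v hu hv huv => ?_⟩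
  · obtain ⟨τ, hu, hv⟩ := q.hasTy_of_mem_preds hq huv
    rw [hev τ u hu, hev τ v hv, hval τ u v ((hcl _ _).2 (.rel _ _ huv))]
  · rw [hev τ u hu, hev τ' v hv, Option.some_inj] at huv
    obtain rfl : τ = τ' := congrArg Sigma.fst huv
    have huv : val τ u = val τ v := by simpa using huv
    rw [← hcl]
    -- An expression with a fresh value is not a constant, so its class lies where `code` is
    -- injective.
    have attr_of : ∀ u, HasTy q.tbl o K sch τ u →
        (¬ ∃ c : dom τ, (⟨τ, c⟩ : Const dom) ∈ K ∧ cl (.const ⟨τ, c⟩) = cl u) →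
        ∃ t a, u = .attr t a := by
      intro u hu hn
      match u, hu with
      | .attr t a, _ => exact ⟨t, a, rfl⟩
      | .const ⟨_, c⟩, ⟨hk, hτ⟩ =>
        subst hτ
        exact absurd ⟨c, hk, rfl⟩ hn
    simp only [val] at huv
    split_ifs at huv with h₁ h₂ h₂
    · rw [← h₁.choose_spec.2, ← h₂.choose_spec.2, huv]
    · exact absurd (huv ▸ h₁.choose_spec.1) (hgK τ _)
    · exact absurd (huv ▸ h₂.choose_spec.1) (hgK τ _)
    · obtain ⟨t, a, rfl⟩ := attr_of u hu h₁
      obtain ⟨t', a', rfl⟩ := attr_of v hv h₂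
      exact hcode (hrange _ _) (hrange _ _) (hg τ huv)

end SQL

/-! ### The answer of a query as a polynomial in the multiplicities of the facts -/

namespace SQL

variable {Ty Rel : Type*} {dom : Ty → Type*} {sch : Rel → List Ty} {o : List Ty}

open Classical in
/-- The multiplicity of `r` in the answer of `q`, as a polynomial in the multiplicities of the
facts, when no facts outside `F` are present. -/
noncomputable def CQ.poly (q : CQ dom sch o) (F : Finset (Fact dom sch)) (r : Row dom o) :
    MvPolynomial (Fact dom sch) ℕ :=
  ∑ f ∈ Fintype.piFinset (fun _ : Fin q.n => F) with q.Match f r,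
    MvPolynomial.monomial (∑ x, Finsupp.single (f x) 1) 1

open Classical in
/-- The instance in which the facts in `F` have the multiplicities `w`. -/
noncomputable def instanceOf (F : Finset (Fact dom sch)) (w : Fact dom sch → ℕ) :
    BagInstance dom sch := fun R =>
  Finsupp.onFinset (F.preimage (fun t => (⟨R, t⟩ : Fact dom sch)) fun a _ b _ h => by simpa using h)
    (fun t => if (⟨R, t⟩ : Fact dom sch) ∈ F then w ⟨R, t⟩ else 0) (fun t ht => by
      refine Finset.mem_preimage.2 ?_
      by_contra h
      exact ht (if_neg h))

theorem instanceOf_apply {F : Finset (Fact dom sch)} {w : Fact dom sch → ℕ} {x : Fact dom sch}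
    (hx : x ∈ F) : instanceOf F w x.1 x.2 = w x := by
  simp [instanceOf, hx]

theorem mem_of_instanceOf_ne_zero {F : Finset (Fact dom sch)} {w : Fact dom sch → ℕ} {R : Rel}
    {t : Row dom (sch R)} (h : instanceOf F w R t ≠ 0) : (⟨R, t⟩ : Fact dom sch) ∈ F := by
  by_contra hn
  exact h (by simp [instanceOf, hn])

theorem CQ.mult_instanceOf (q : CQ dom sch o) (F : Finset (Fact dom sch))
    (w : Fact dom sch → ℕ) (r : Row dom o) :
    q.mult (instanceOf F w) r = MvPolynomial.eval w (q.poly F r) := by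
  classical
  have hw : ∀ f : Fin q.n → Fact dom sch, MvPolynomial.eval w
      (MvPolynomial.monomial (∑ x, Finsupp.single (f x) 1) 1) = ∏ x, w (f x) := by
    intro f
    rw [MvPolynomial.monomial_sum_one, map_prod]
    exact Finset.prod_congr rfl fun x _ => MvPolynomial.eval_X _
  rw [CQ.mult, CQ.poly, map_sum, ← Finset.sum_filter]
  simp only [hw]
  -- The index sets differ by bindings that use facts of weight zero, so only the nonzero summands
  -- are in bijection.
  refine Finset.sum_bij_ne_zero (fun t _ _ x => (⟨q.tbl x, t x⟩ : Fact dom sch)) ?_ ?_ ?_ ?_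
  · intro t ht _
    rw [Finset.mem_filter, Fintype.mem_piFinset] at ht ⊢
    exact ⟨fun x => mem_of_instanceOf_ne_zero (Finsupp.mem_support_iff.1 (ht.1 x)),
      (q.match_iff t r).2 ht.2⟩
  · intro t _ _ t' _ _ h
    funext x
    simpa using congrFun h x
  · intro f hf hne
    rw [Finset.mem_filter, Fintype.mem_piFinset] at hf
    obtain ⟨hF, hm⟩ := hf
    obtain ⟨t, rfl⟩ : ∃ t : (x : Fin q.n) → Row dom (sch (q.tbl x)),
        f = fun x => ⟨q.tbl x, t x⟩ := by
      have : ∀ x, ∃ t : Row dom (sch (q.tbl x)), f x = ⟨q.tbl x, t⟩ := by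
        intro x
        rw [← hm.1 x]
        exact ⟨(f x).2, rfl⟩
      choose t ht using this
      exact ⟨t, funext ht⟩
    have hI : ∀ x, instanceOf F w (q.tbl x) (t x) = w ⟨q.tbl x, t x⟩ := fun x =>
      instanceOf_apply (hF x)
    refine ⟨t, ?_, ?_, rfl⟩
    · rw [Finset.mem_filter, Fintype.mem_piFinset]
      refine ⟨fun x => Finsupp.mem_support_iff.2 ?_, (q.match_iff t r).1 hm⟩
      rw [hI]
      exact Finset.prod_ne_zero_iff.1 hne x (Finset.mem_univ x)
    · simpa only [hI] using hne
  · intro t ht _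
    rw [Finset.mem_filter, Fintype.mem_piFinset] at ht
    exact Finset.prod_congr rfl fun x _ => instanceOf_apply (x := ⟨q.tbl x, t x⟩)
      (mem_of_instanceOf_ne_zero (Finsupp.mem_support_iff.1 (ht.1 x)))

/-- Over the domain `ℤ`, a polynomial is determined by its values on an infinite grid, here that of
the natural numbers. -/
theorem mvPolynomial_eq_of_eval_nat_eq {σ : Type*} {p q : MvPolynomial σ ℕ}
    (h : ∀ w : σ → ℕ, MvPolynomial.eval w p = MvPolynomial.eval w q) : p = q := by
  apply MvPolynomial.map_injective (Nat.castRingHom ℤ) Nat.cast_injective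
  refine MvPolynomial.funext_set (fun _ => Set.range (Nat.cast : ℕ → ℤ))
    (fun _ => Set.infinite_range_of_injective Nat.cast_injective) fun x hx => ?_
  choose w hw using fun i => hx i (Set.mem_univ i)
  obtain rfl : (fun i => Nat.castRingHom ℤ (w i)) = x := funext hw
  have key : ∀ s : MvPolynomial σ ℕ, MvPolynomial.eval (fun i => Nat.castRingHom ℤ (w i))
      (MvPolynomial.map (Nat.castRingHom ℤ) s) = (MvPolynomial.eval w s : ℕ) := by
    intro s
    rw [MvPolynomial.eval_map]
    exact (MvPolynomial.eval₂_comp_left (Nat.castRingHom ℤ) (RingHom.id ℕ) w s).symm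
  rw [key, key, h]

theorem BagEquivalent.sum_poly_eq {q₁ q₂ : UCQ dom sch o} (h : BagEquivalent q₁ q₂)
    (F : Finset (Fact dom sch)) (r : Row dom o) :
    (q₁.map fun c => c.poly F r).sum = (q₂.map fun c => c.poly F r).sum := by
  refine mvPolynomial_eq_of_eval_nat_eq fun w => ?_
  have := h (instanceOf F w) r
  simpa only [UCQ.mult, map_list_sum, List.map_map, Function.comp_def,
    CQ.mult_instanceOf] using this

open Classical in
-- Natural coefficients do not cancel, so a single matching binding already makes the coefficient
-- nonzero.
theorem CQ.coeff_poly_ne_zero_iff (q : CQ dom sch o) (F : Finset (Fact dom sch)) (r : Row dom o)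
    (m : Fact dom sch →₀ ℕ) :
    (q.poly F r).coeff m ≠ 0 ↔ ∃ f : Fin q.n → Fact dom sch, (∀ x, f x ∈ F) ∧ q.Match f r ∧
      ∑ x, Finsupp.single (f x) 1 = m := by
  rw [CQ.poly, MvPolynomial.coeff_sum, Ne, Finset.sum_eq_zero_iff]
  simp [MvPolynomial.coeff_monomial]

/-- The coefficient at `a` counts the fibre over `a`. Fibres of equal size are in bijection, and
these bijections glue; `f` and `g` may repeat values. -/
theorem exists_equiv_of_sum_single_eq {α : Type*} {n n' : ℕ} {f : Fin n → α} {g : Fin n' → α}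
    (h : ∑ x, Finsupp.single (f x) 1 = (∑ x, Finsupp.single (g x) 1 : α →₀ ℕ)) :
    ∃ e : Fin n ≃ Fin n', ∀ x, f x = g (e x) := by
  classical
  have hc : ∀ a, Nonempty ({x // f x = a} ≃ {x // g x = a}) := by
    intro a
    have := DFunLike.congr_fun h a
    simp only [Finsupp.finsetSum_apply, Finsupp.single_apply, Finset.sum_boole] at this
    refine ⟨Fintype.equivOfCardEq ?_⟩
    simpa [Fintype.card_subtype] using this
  let E := fun a => (hc a).some
  refine ⟨(Equiv.sigmaFiberEquiv f).symm.trans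
    ((Equiv.sigmaCongrRight E).trans (Equiv.sigmaFiberEquiv g)), fun x => ?_⟩
  exact (E (f x) ⟨x, rfl⟩).2.symm

end SQL

/-! ### Coverings and isomorphisms of queries -/

namespace SQL

variable {Ty Rel : Type*} {dom : Ty → Type*} {sch : Rel → List Ty} {o : List Ty}

/-- Every binding of `c` is, via the bijection `e` of the table aliases, a binding of `d`. -/
def CQ.CoversVia (d c : CQ dom sch o) (e : Fin d.n ≃ Fin c.n) : Prop :=
  ∀ f r, c.Match f r → d.Match (f ∘ e) r

/-- `d` is obtained from `c` by renaming aliases and weakening the WHERE clause. -/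
def CQ.Covers (d c : CQ dom sch o) : Prop := ∃ e, d.CoversVia c e

/-- Two queries have the same bindings up to a bijection of the table aliases. -/
def CQ.Iso (c d : CQ dom sch o) : Prop :=
  ∃ e : Fin d.n ≃ Fin c.n, ∀ f r, c.Match f r ↔ d.Match (f ∘ e) r

theorem CQ.Covers.trans {b c d : CQ dom sch o} (h₁ : d.Covers c) (h₂ : c.Covers b) :
    d.Covers b := by
  obtain ⟨e₁, h₁⟩ := h₁
  obtain ⟨e₂, h₂⟩ := h₂
  exact ⟨e₁.trans e₂, fun f r h => h₁ _ _ (h₂ _ _ h)⟩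

theorem CQ.Iso.symm {c d : CQ dom sch o} (h : c.Iso d) : d.Iso c := by
  obtain ⟨e, h⟩ := h
  refine ⟨e.symm, fun f r => ?_⟩
  rw [h]
  simp [Function.comp_assoc]

/-- The two coverings compose to a permutation `π` of the aliases of `c` that preserves matches. Its
inverse is the power `π ^ (orderOf π - 1)`, so it preserves them too, and the covering along `e` can
be reversed. -/
theorem CQ.Covers.iso {c d : CQ dom sch o} (h₁ : d.Covers c) (h₂ : c.Covers d) : c.Iso d := by
  obtain ⟨e, he⟩ := h₁
  obtain ⟨e', he'⟩ := h₂
  refine ⟨e, fun f r => ⟨he f r, fun h => ?_⟩⟩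
  let π : Equiv.Perm (Fin c.n) := e'.trans e
  have hπ : ∀ k f, c.Match f r → c.Match (f ∘ (π ^ k : Equiv.Perm _)) r := by
    intro k
    induction k with
    | zero => intro f h; simpa using h
    | succ k ih =>
      intro f h
      have := he' _ _ (he _ _ (ih f h))
      rwa [pow_succ, Equiv.Perm.coe_mul]
  have := hπ (orderOf π - 1) _ (he' _ _ h)
  have hp : π * π ^ (orderOf π - 1) = 1 := by
    rw [← pow_succ', Nat.sub_add_cancel (orderOf_pos π), pow_orderOf_eq_one]
  have hf : ((f ∘ e) ∘ e') ∘ (π ^ (orderOf π - 1) : Equiv.Perm _) = f := by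
    have := congrArg (fun σ : Equiv.Perm (Fin c.n) => f ∘ σ) hp
    simpa [Equiv.Perm.coe_mul, π, ← Function.comp_assoc] using this
  rwa [hf] at this

theorem CQ.Iso.poly_eq {c d : CQ dom sch o} (h : c.Iso d) (F : Finset (Fact dom sch))
    (r : Row dom o) : c.poly F r = d.poly F r := by
  classical
  obtain ⟨e, h⟩ := h
  rw [CQ.poly, CQ.poly]
  refine Finset.sum_equiv (e.symm.arrowCongr (Equiv.refl _)) (fun f => ?_) (fun f _ => ?_)
  · have hf : (e.symm.arrowCongr (Equiv.refl _)) f = f ∘ e := rfl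
    simp only [Finset.mem_filter, Fintype.mem_piFinset, hf, h f r, Function.comp_apply]
    exact and_congr_left fun _ => ⟨fun h y => h _, fun h x => by simpa using h (e.symm x)⟩
  · exact congrArg (fun m => MvPolynomial.monomial m 1)
      (Equiv.sum_comp e fun x => Finsupp.single (f x) 1).symm

/-! ### Renaming of aliases in expressions -/

/-- `p` renames tuple variables as prescribed by `e`. -/
def Renames {n m : ℕ} (e : Fin n ≃ Fin m) (p : UExp.Tup → UExp.Tup) : Prop :=
  (∀ y : Fin n, p (.var y) = .var (e y)) ∧ p .out = .out

theorem exists_renames {n m : ℕ} (e : Fin n ≃ Fin m) : ∃ p, Renames e p :=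
  ⟨fun t => match t with
    | .var x => if h : x < n then .var (e ⟨x, h⟩) else .var x
    | .out => .out, fun y => by simp, rfl⟩

theorem exprVal_var {n : ℕ} (f : Fin n → Fact dom sch) (r : Row dom o) (x : Fin n) (a : ℕ) :
    exprVal f r (.attr (.var x) a) =
      if h : a < (sch (f x).1).length then some ⟨_, (f x).2 ⟨a, h⟩⟩ else none := by
  have hx : (∃ hx : (x : ℕ) < n, a < (sch (f ⟨x, hx⟩).1).length) ↔
      a < (sch (f x).1).length := ⟨fun h => h.2, fun h => ⟨x.2, h⟩⟩
  by_cases h : a < (sch (f x).1).length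
  · simp only [exprVal]
    rw [dif_pos (hx.2 h), dif_pos h]
  · simp only [exprVal]
    rw [dif_neg (fun h' => h (hx.1 h')), dif_neg h]

/-- `HasTy` ensures that a variable in `u` is an alias; on other variables `p` is arbitrary. -/
theorem Renames.exprVal_subst {n m : ℕ} {e : Fin n ≃ Fin m} {p : UExp.Tup → UExp.Tup}
    (hp : Renames e p) (f : Fin m → Fact dom sch) (r : Row dom o) {tbl : Fin n → Rel}
    {K : Set (Const dom)} {τ : Ty} {u : UExp.Expr (Const dom)} (hu : HasTy tbl o K sch τ u) :
    exprVal f r (u.subst p) = exprVal (f ∘ e) r u := by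
  match u, hu with
  | .attr (.var x) a, ⟨hx, _⟩ =>
    rw [UExp.Expr.subst, hp.1 ⟨x, hx⟩, exprVal_var]
    exact (exprVal_var (f ∘ e) r ⟨x, hx⟩ a).symm
  | .attr .out a, _ => rw [UExp.Expr.subst, hp.2]; rfl
  | .const k, _ => rfl

theorem Renames.hasTy_subst {n m : ℕ} {e : Fin n ≃ Fin m} {p : UExp.Tup → UExp.Tup}
    (hp : Renames e p) {tbl : Fin n → Rel} {tbl' : Fin m → Rel} (ht : ∀ y, tbl' (e y) = tbl y)
    {K : Set (Const dom)} {τ : Ty} {u : UExp.Expr (Const dom)} (hu : HasTy tbl o K sch τ u) :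
    HasTy tbl' o K sch τ (u.subst p) := by
  match u, hu with
  | .attr (.var x) a, ⟨hx, h⟩ =>
    rw [UExp.Expr.subst, hp.1 ⟨x, hx⟩]
    refine ⟨(e ⟨x, hx⟩).2, ?_⟩
    rw [← ht ⟨x, hx⟩] at h
    exact h
  | .attr .out a, h => rw [UExp.Expr.subst, hp.2]; exact h
  | .const k, h => exact h

theorem Renames.subst_subst {n m : ℕ} {e : Fin n ≃ Fin m} {p p' : UExp.Tup → UExp.Tup}
    (hp : Renames e p) (hp' : Renames e.symm p') {tbl : Fin m → Rel}
    {K : Set (Const dom)} {τ : Ty} {u : UExp.Expr (Const dom)} (hu : HasTy tbl o K sch τ u) :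
    (u.subst p').subst p = u := by
  match u, hu with
  | .attr (.var x) a, ⟨hx, h⟩ =>
    rw [UExp.Expr.subst, hp'.1 ⟨x, hx⟩, UExp.Expr.subst, hp.1]
    simp
  | .attr .out a, h => rw [UExp.Expr.subst, hp'.2, UExp.Expr.subst, hp.2]
  | .const k, h => rfl

theorem CQ.tbl_eq_of_match {c d : CQ dom sch o} {e : Fin d.n ≃ Fin c.n}
    {f : Fin c.n → Fact dom sch} {r : Row dom o} (hc : c.Match f r) (hd : d.Match (f ∘ e) r)
    (y : Fin d.n) : c.tbl (e y) = d.tbl y :=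
  (hc.1 (e y)).symm.trans (hd.1 y)

/-- If `d` matches a generic binding of `c`, then its equalities follow from those of `c`. -/
theorem CQ.cong_subst_of_generic {c d : CQ dom sch o} {e : Fin d.n ≃ Fin c.n}
    {K : Set (Const dom)} (hd : d.consts ⊆ K) {f : Fin c.n → Fact dom sch} {r : Row dom o}
    (hm : c.Match f r)
    (hgen : ∀ τ τ' u v, HasTy c.tbl o K sch τ u → HasTy c.tbl o K sch τ' v →
      exprVal f r u = exprVal f r v → UExp.Cong c.toUExp.preds u v)
    (hdm : d.Match (f ∘ e) r) {p : UExp.Tup → UExp.Tup} (hp : Renames e p)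
    {u v : UExp.Expr (Const dom)} (huv : UExp.Pred.eq u v ∈ d.toUExp.preds) :
    UExp.Cong c.toUExp.preds (u.subst p) (v.subst p) := by
  obtain ⟨τ, hu, hv⟩ := d.hasTy_of_mem_preds hd huv
  have ht := CQ.tbl_eq_of_match hm hdm
  refine hgen τ τ _ _ (hp.hasTy_subst ht hu) (hp.hasTy_subst ht hv) ?_
  rw [hp.exprVal_subst f r hu, hp.exprVal_subst f r hv]
  exact hdm.2 u v huv

/-- The renamed equalities of `d` are congruence consequences of those of `c`, hence hold in every
binding of `c`, not just the generic one. -/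
theorem CQ.coversVia_of_generic {c d : CQ dom sch o} {e : Fin d.n ≃ Fin c.n}
    {K : Set (Const dom)} (hd : d.consts ⊆ K) {f : Fin c.n → Fact dom sch} {r : Row dom o}
    (hm : c.Match f r)
    (hgen : ∀ τ τ' u v, HasTy c.tbl o K sch τ u → HasTy c.tbl o K sch τ' v →
      exprVal f r u = exprVal f r v → UExp.Cong c.toUExp.preds u v)
    (hdm : d.Match (f ∘ e) r) : d.CoversVia c e := by
  obtain ⟨p, hp⟩ := exists_renames e
  refine fun f' r' h => ⟨fun y => ?_, fun u v huv => ?_⟩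
  · rw [← CQ.tbl_eq_of_match hm hdm y, Function.comp_apply, h.1]
  · obtain ⟨τ, hu, hv⟩ := d.hasTy_of_mem_preds hd huv
    rw [← hp.exprVal_subst f' r' hu, ← hp.exprVal_subst f' r' hv]
    exact h.cong (CQ.cong_subst_of_generic hd hm hgen hdm hp huv)

/-- The passage from bindings back to syntax: the covering is tested on one generic binding of `c`.
-/
theorem CQ.CoversVia.cong_subst [∀ τ, Infinite (dom τ)] {c d : CQ dom sch o}
    {e : Fin d.n ≃ Fin c.n} (h : d.CoversVia c e) (hc : c.Satisfiable)
    {p : UExp.Tup → UExp.Tup} (hp : Renames e p) {u v : UExp.Expr (Const dom)}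
    (huv : UExp.Pred.eq u v ∈ d.toUExp.preds) :
    UExp.Cong c.toUExp.preds (u.subst p) (v.subst p) := by
  obtain ⟨f, r, hm, hgen⟩ := hc.exists_generic (c.finite_consts.union d.finite_consts)
    Set.subset_union_left
  exact CQ.cong_subst_of_generic Set.subset_union_right hm hgen (h f r hm) hp huv

/-! ### Bag equivalent unions consist of isomorphic queries -/

theorem exists_covers_of_sum_poly_eq [∀ τ, Infinite (dom τ)] {q₁ q₂ : Multiset (CQ dom sch o)}
    (h : ∀ F r, (q₁.map fun c => c.poly F r).sum = (q₂.map fun c => c.poly F r).sum)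
    {c : CQ dom sch o} (hc : c ∈ q₁) (hs : c.Satisfiable) : ∃ d ∈ q₂, d.Covers c := by
  classical
  -- The binding is fixed before `d` is found, so it must be generic for the constants of all
  -- queries in `q₂`.
  have hK : (c.consts ∪ ⋃ d ∈ {d | d ∈ q₂}, d.consts).Finite :=
    c.finite_consts.union (q₂.finite_toSet.biUnion fun d _ => d.finite_consts)
  obtain ⟨f, r, hm, hgen⟩ := hs.exists_generic hK Set.subset_union_left
  let F := Finset.univ.image f
  let m : Fact dom sch →₀ ℕ := ∑ x, Finsupp.single (f x) 1
  have hcoeff : ∀ q : Multiset (CQ dom sch o),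
      (q.map fun c : CQ dom sch o => c.poly F r).sum.coeff m = (q.map fun c : CQ dom sch o => (c.poly F r).coeff m).sum :=
    fun q => by
      rw [← MvPolynomial.coeffAddMonoidHom_apply, map_multiset_sum, Multiset.map_map]
      rfl
  have h₁ : (q₁.map fun c => (c.poly F r).coeff m).sum ≠ 0 := fun h0 =>
    (c.coeff_poly_ne_zero_iff F r m).2 ⟨f, fun x => Finset.mem_image_of_mem f (Finset.mem_univ x),
      hm, rfl⟩ (Multiset.sum_eq_zero_iff.1 h0 _ (Multiset.mem_map_of_mem _ hc))
  rw [← hcoeff, h, hcoeff, Ne, Multiset.sum_eq_zero_iff] at h₁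
  push Not at h₁
  obtain ⟨_, hmem, hne⟩ := h₁
  obtain ⟨d, hd, rfl⟩ := Multiset.mem_map.1 hmem
  obtain ⟨g, -, hg, hsum⟩ := (d.coeff_poly_ne_zero_iff F r m).1 hne
  obtain ⟨e, he⟩ := exists_equiv_of_sum_single_eq hsum
  obtain rfl : g = f ∘ e := funext he
  refine ⟨d, hd, e, CQ.coversVia_of_generic ?_ hm hgen hg⟩
  exact (Set.subset_biUnion_of_mem (u := CQ.consts) (s := {d | d ∈ q₂}) hd).trans
    Set.subset_union_right

/-- Covering is not antisymmetric, so maximality is stated as `r x m → r m x`. A new element `a`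
replaces the old maximal `m` exactly when `r a m`. -/
theorem exists_maximal_of_trans {α : Type*} {r : α → α → Prop}
    (ht : ∀ a b c, r a b → r b c → r a c) (s : Multiset α) (hs : s ≠ 0) :
    ∃ m ∈ s, ∀ x ∈ s, r x m → r m x := by
  induction s using Multiset.induction with
  | empty => exact absurd rfl hs
  | cons a s ih =>
    rcases eq_or_ne s 0 with rfl | hs'
    · exact ⟨a, by simp, by simp⟩
    obtain ⟨m, hm, hmax⟩ := ih hs'
    by_cases ham : r a m
    · refine ⟨a, by simp, fun x hx hxa => ?_⟩
      rcases Multiset.mem_cons.1 hx with rfl | hx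
      · exact hxa
      · exact ht _ _ _ ham (hmax x hx (ht _ _ _ hxa ham))
    · refine ⟨m, Multiset.mem_cons_of_mem hm, fun x hx hxm => ?_⟩
      rcases Multiset.mem_cons.1 hx with rfl | hx
      · exact absurd hxm ham
      · exact hmax x hx hxm

theorem rel_iso_of_sum_poly_eq [∀ τ, Infinite (dom τ)] (q₁ q₂ : Multiset (CQ dom sch o))
    (h₁ : ∀ c ∈ q₁, c.Satisfiable) (h₂ : ∀ c ∈ q₂, c.Satisfiable)
    (h : ∀ F r, (q₁.map fun c => c.poly F r).sum = (q₂.map fun c => c.poly F r).sum) :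
    Multiset.Rel CQ.Iso q₁ q₂ := by
  classical
  induction hn : q₁.card generalizing q₁ q₂ with
  | zero =>
    obtain rfl := Multiset.card_eq_zero.1 hn
    rw [Multiset.rel_zero_left]
    by_contra hne
    obtain ⟨c, hc⟩ := Multiset.exists_mem_of_ne_zero hne
    obtain ⟨d, hd, -⟩ := exists_covers_of_sum_poly_eq (fun F r => (h F r).symm) hc (h₂ c hc)
    simp at hd
  | succ n ih =>
    have key : ∃ c ∈ q₁, ∃ d ∈ q₂, c.Iso d := by
      -- Maximality is taken over both unions because the query covering `c` comes from the side
      -- opposite to `c`.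
      obtain ⟨c, hc, hmax⟩ := exists_maximal_of_trans (r := CQ.Covers)
        (fun _ _ _ h₁ h₂ => CQ.Covers.trans h₁ h₂) (q₁ + q₂) (by
          intro h0
          have := congrArg Multiset.card h0
          simp [hn] at this)
      rcases Multiset.mem_add.1 hc with hc | hc
      · obtain ⟨d, hd, hdc⟩ := exists_covers_of_sum_poly_eq h hc (h₁ c hc)
        exact ⟨c, hc, d, hd, hdc.iso (hmax d (Multiset.mem_add.2 (Or.inr hd)) hdc)⟩
      · obtain ⟨d, hd, hdc⟩ := exists_covers_of_sum_poly_eq (fun F r => (h F r).symm) hc (h₂ c hc)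
        exact ⟨d, hd, c, hc, (hdc.iso (hmax d (Multiset.mem_add.2 (Or.inl hd)) hdc)).symm⟩
    obtain ⟨c, hc, d, hd, hcd⟩ := key
    obtain ⟨s₁, rfl⟩ := Multiset.exists_cons_of_mem hc
    obtain ⟨s₂, rfl⟩ := Multiset.exists_cons_of_mem hd
    refine Multiset.Rel.cons hcd (ih s₁ s₂ (fun x hx => h₁ x (Multiset.mem_cons_of_mem hx))
      (fun x hx => h₂ x (Multiset.mem_cons_of_mem hx)) (fun F r => ?_) (by simpa using hn))
    have := h F r
    rw [Multiset.map_cons, Multiset.map_cons, Multiset.sum_cons, Multiset.sum_cons,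
      hcd.poly_eq] at this
    exact add_left_cancel this

/-- The order of `l₂` is kept, since `udp` permutes only the terms of the first sum. -/
theorem exists_coe_eq_forall₂_of_rel {α β : Type*} {r : α → β → Prop} {s : Multiset α}
    {l₂ : List β} (h : Multiset.Rel r s l₂) :
    ∃ l : List α, (l : Multiset α) = s ∧ List.Forall₂ r l l₂ := by
  induction l₂ generalizing s with
  | nil =>
    rw [Multiset.coe_nil, Multiset.rel_zero_right] at h
    exact ⟨[], h.symm, .nil⟩
  | cons b l₂ ih =>
    rw [← Multiset.cons_coe, Multiset.rel_cons_right] at h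
    obtain ⟨a, s', hab, hs, rfl⟩ := h
    obtain ⟨l, rfl, hl⟩ := ih hs
    exact ⟨a :: l, rfl, .cons hab hl⟩

end SQL

/-! ### The decision procedure accepts isomorphic queries -/

namespace UExp

theorem lookup_map_of_injective {α β γ : Type*} [DecidableEq β] {f : α → β} (hf : f.Injective)
    (g : α → γ) {l : List α} {a : α} (ha : a ∈ l) :
    (l.map fun a => (f a, g a)).lookup (f a) = some (g a) := by
  induction l with
  | nil => simp at ha
  | cons b l ih =>
    rw [List.map_cons, List.lookup_cons]
    by_cases h : a = b
    · subst h
      simp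
    · have hn : (f a == f b) = false := by simpa using fun h' => h (hf h')
      rw [hn]
      exact ih ((List.mem_cons.1 ha).resolve_left h)

theorem ofFn_comp_equiv_perm {α : Type*} {n m : ℕ} (e : Fin n ≃ Fin m) (g : Fin m → α) :
    (List.ofFn fun y => g (e y)).Perm (List.ofFn g) := by
  have h : ((List.finRange n).map e).Perm (List.finRange m) := by
    rw [List.perm_ext_iff_of_nodup ((List.nodup_finRange n).map e.injective)
      (List.nodup_finRange m)]
    exact fun x => by simpa using ⟨e.symm x, by simp⟩
  simpa [List.ofFn_eq_map, Function.comp_def] using h.map g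

theorem predsEquiv_of_cong {C : Type*} [DecidableEq C] {ps qs : List (Pred C)}
    (hp : AllScalar ps) (hq : AllScalar qs) (h₁ : ∀ u v, Pred.eq u v ∈ qs → Cong ps u v)
    (h₂ : ∀ u v, Pred.eq u v ∈ ps → Cong qs u v) : predsEquiv ps qs = true := by
  rw [predsEquiv, Bool.and_eq_true, List.all_eq_true, List.all_eq_true]
  refine ⟨fun p hm => ?_, fun p hm => ?_⟩
  · obtain ⟨u, v, rfl⟩ := hq p hm
    exact (hp.implies_eq_iff u v).2 (h₁ u v hm)
  · obtain ⟨u, v, rfl⟩ := hp p hm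
    exact (hq.implies_eq_iff u v).2 (h₂ u v hm)

end UExp

namespace SQL

variable {Ty Rel : Type*} {dom : Ty → Type*} {sch : Rel → List Ty} {o : List Ty}

theorem renames_varMap {n m : ℕ} (e : Fin n ≃ Fin m) :
    Renames e (UExp.varMap (List.ofFn fun y : Fin n => (y : ℕ))
      (List.ofFn fun y => (e y : ℕ))) := by
  refine ⟨fun y => ?_, rfl⟩
  rw [UExp.varMap, List.ofFn_eq_map, List.ofFn_eq_map, List.zip_map',
    UExp.lookup_map_of_injective Fin.val_injective _ (List.mem_finRange y), Option.getD_some]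

theorem CQ.canonize_toUExp [DecidableEq (Const dom)] (q : CQ dom sch o) :
    q.toUExp.canonize = q.toUExp.tc := by
  refine UExp.Term.canonize_eq_tc q.allScalar_preds fun v hv => ?_
  obtain ⟨x, rfl⟩ := List.mem_ofFn.1 hv
  exact ⟨_, List.mem_ofFn.2 ⟨x, rfl⟩, rfl⟩

theorem CQ.Iso.predsEquiv [DecidableEq (Const dom)] [∀ τ, Infinite (dom τ)] {c d : CQ dom sch o}
    {e : Fin d.n ≃ Fin c.n} (h : ∀ f r, c.Match f r ↔ d.Match (f ∘ e) r) (hc : c.Satisfiable)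
    (hd : d.Satisfiable) {p : UExp.Tup → UExp.Tup} (hp : Renames e p) :
    UExp.predsEquiv c.toUExp.tc.preds (d.toUExp.tc.preds.map (UExp.Pred.subst p)) = true := by
  have hdc : d.CoversVia c e := fun f r => (h f r).1
  have hcd : c.CoversVia d e.symm := fun f r hf => (h _ r).2 (by
    rwa [Function.comp_assoc, Equiv.symm_comp_self, Function.comp_id])
  refine UExp.predsEquiv_of_cong c.allScalar_preds.tc (d.allScalar_preds.tc.map_subst p)
    (fun u v huv => ?_) (fun u v huv => ?_)
  · obtain ⟨q, hq, he⟩ := List.mem_map.1 huv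
    obtain ⟨u', v', rfl, hcong⟩ := UExp.Term.tc_preds_spec d.allScalar_preds q hq
    cases he
    rw [UExp.Term.cong_tc_iff c.allScalar_preds]
    refine UExp.Cong.mono (fun a b hab => ?_) (hcong.subst p)
    obtain ⟨q', hq', he'⟩ := List.mem_map.1 hab
    obtain ⟨a', b', rfl⟩ := d.allScalar_preds q' hq'
    cases he'
    exact hdc.cong_subst hc hp hq'
  -- An equality of `c` is carried to `d` by `p'`, derived there, and carried back by `p`; on
  -- well-typed expressions the round trip is the identity.
  · obtain ⟨p', hp'⟩ := exists_renames e.symm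
    have hcong : UExp.Cong c.toUExp.preds u v := by
      rw [← UExp.Term.cong_tc_iff c.allScalar_preds]
      exact .rel _ _ huv
    refine UExp.Cong.mono (fun a b hab => ?_) hcong
    obtain ⟨τ, ha, hb⟩ := c.hasTy_of_mem_preds subset_rfl hab
    have := ((UExp.Term.cong_tc_iff d.allScalar_preds _ _).2
      (hcd.cong_subst hd hp' hab)).subst p
    rwa [hp.subst_subst hp' ha, hp.subst_subst hp' hb] at this

theorem CQ.Iso.tdp [DecidableEq Ty] [DecidableEq Rel] [DecidableEq (Const dom)]
    [∀ τ, Infinite (dom τ)] {c d : CQ dom sch o} (h : c.Iso d) (hc : c.Satisfiable)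
    (hd : d.Satisfiable) : UExp.tdp c.toUExp.tc d.toUExp.tc = true := by
  obtain ⟨e, h⟩ := h
  -- An actual binding is needed to compare relation names: without one, `h` could hold vacuously.
  have ht : ∀ y, c.tbl (e y) = d.tbl y := by
    obtain ⟨f, r, hm⟩ := hc.exists_match
    exact CQ.tbl_eq_of_match hm ((h f r).1 hm)
  rw [UExp.tdp, List.any_eq_true]
  -- The variables of `c`, listed in the order of their partners in `d`, so that `varMap` becomes
  -- the renaming by `e`.
  refine ⟨List.ofFn fun y => ((e y : ℕ), sch (c.tbl (e y))), List.mem_permutations.2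
    (UExp.ofFn_comp_equiv_perm e fun x => ((x : ℕ), sch (c.tbl x))), ?_⟩
  have hl : (List.ofFn fun y => ((e y : ℕ), sch (c.tbl (e y)))).map Prod.fst =
      List.ofFn fun y => (e y : ℕ) := by
    rw [List.map_ofFn]; rfl
  have hv : d.toUExp.tc.vars.map Prod.fst = List.ofFn fun y : Fin d.n => (y : ℕ) := by
    rw [show d.toUExp.tc.vars = List.ofFn fun x : Fin d.n => ((x : ℕ), sch (d.tbl x)) from rfl,
      List.map_ofFn]
    rfl
  have hp := renames_varMap e
  simp only [hl, hv, Bool.and_eq_true, decide_eq_true_eq]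
  refine ⟨?_, CQ.Iso.predsEquiv h hc hd hp, ?_⟩
  · rw [show d.toUExp.tc.vars = List.ofFn fun x : Fin d.n => ((x : ℕ), sch (d.tbl x)) from rfl,
      List.map_ofFn, List.map_ofFn]
    exact congrArg List.ofFn (funext fun y => by simp [ht])
  · rw [show d.toUExp.tc.atoms = List.ofFn fun x : Fin d.n => (d.tbl x, UExp.Tup.var x) from rfl,
      List.map_ofFn]
    have := (UExp.ofFn_comp_equiv_perm e fun x => (c.tbl x, UExp.Tup.var (x : ℕ))).symm
    refine this.trans (List.Perm.of_eq (congrArg List.ofFn (funext fun y => ?_)))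
    simp [ht, hp.1]

theorem udp_of_forall₂_iso [DecidableEq Ty] [DecidableEq Rel] [DecidableEq (Const dom)]
    [∀ τ, Infinite (dom τ)] {q₁ q₂ l : UCQ dom sch o} (hl : l.Perm q₁)
    (hiso : List.Forall₂ CQ.Iso l q₂) (h₁ : ∀ c ∈ q₁, c.Satisfiable)
    (h₂ : ∀ c ∈ q₂, c.Satisfiable) : UExp.udp (UCQ.toUExp q₁) (UCQ.toUExp q₂) = true := by
  have hcan : ∀ q : UCQ dom sch o, UExp.canonize (UCQ.toUExp q) = q.map fun c => c.toUExp.tc := by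
    intro q
    simp [UExp.canonize, UCQ.toUExp, Function.comp_def, CQ.canonize_toUExp]
  have hlen : q₁.length = q₂.length := hl.length_eq.symm.trans hiso.length_eq
  simp only [UExp.udp, hcan, List.length_map, hlen, ne_eq, not_true_eq_false, if_false]
  rw [List.any_eq_true]
  refine ⟨l.map fun c => c.toUExp.tc, List.mem_permutations.2 (hl.map _), ?_⟩
  replace h₁ : ∀ c ∈ l, c.Satisfiable := fun c hc => h₁ c (hl.subset hc)
  clear hl hlen
  induction hiso with
  | nil => rfl
  | cons hcd _ ih =>
    simp only [List.map_cons, List.zip_cons_cons, List.all_cons, Bool.and_eq_true]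
    exact ⟨hcd.tdp (h₁ _ (by simp)) (h₂ _ (by simp)),
      ih (fun c hc => h₂ c (List.mem_cons_of_mem _ hc))
        (fun c hc => h₁ c (List.mem_cons_of_mem _ hc))⟩

end SQL

theorem mainTheorem3 {Ty Rel : Type*} [DecidableEq Ty] [DecidableEq Rel]
    (dom : Ty → Type*) [∀ τ, DecidableEq (dom τ)] [∀ τ, Infinite (dom τ)]
    (sch : Rel → List Ty) (o : List Ty) (q₁ q₂ : SQL.UCQ dom sch o)
    (h₁ : ∀ c ∈ q₁, c.Satisfiable) (h₂ : ∀ c ∈ q₂, c.Satisfiable)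
    (h : SQL.BagEquivalent q₁ q₂) :
    UExp.udp (SQL.UCQ.toUExp q₁) (SQL.UCQ.toUExp q₂) = true := by
  have hrel := SQL.rel_iso_of_sum_poly_eq (q₁ : Multiset (SQL.CQ dom sch o)) q₂
    (by simpa using h₁) (by simpa using h₂)
    (fun F r => by simpa using h.sum_poly_eq F r)
  obtain ⟨l, hl, hiso⟩ := SQL.exists_coe_eq_forall₂_of_rel hrel
  exact SQL.udp_of_forall₂_iso (Multiset.coe_eq_coe.1 hl) hiso h₁ h₂
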